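/- Let $\varphi=\frac{1+\sqrt5}{2}$, and let $D\subset\mathbb{R}^3$ be the solid regular dodecahedron centred at the origin, that is, $D=\{x:\langle v,x\rangle\le 1 \text{ for all } v\in V\}$, where $V$ consists of the twelve vertices $(0,\pm1,\pm\varphi)$, $(\pm\varphi,0,\pm1)$, $(\pm1,\pm\varphi,0)$ of a regular icosahedron. Let $X$ be a three-dimensional real normed space whose closed unit ball is a regular dodecahedron, i.e. is carried onto $D$ by some linear isomorphism $X\to\mathbb{R}^3$. For $x_1,x_2,x_3\in X$ let $\operatorname{ft}(x_1,x_2,x_3)$ be the set of solutions of the Fermat--Torricelli problem, that is, the set of points $p\in X$ at which the function $p\mapsto\sum_{i=1}^3\|p-x_i\|$ attains its minimum over $X$. Then: 1. there are three distinct points $x_1,x_2,x_3\in X$ for which the solution is not unique, i.e. $\operatorname{ft}(x_1,x_2,x_3)$ has more than one element; 2. for any points $x_1,x_2,x_3\in X$ for which the solution is not unique, $\operatorname{ft}(x_1,x_2,x_3)$ is a segment $[p,q]$ with $p\neq q$. -/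

import Mathlib

/-- The set of solutions of the Fermat-Torricelli problem for the points `a 0, ..., a (n - 1)`:
the points at which the sum of the distances to the given points attains its minimum. -/
def fermatTorricelli {X : Type*} [MetricSpace X] {n : ℕ} (a : Fin n → X) : Set X :=
  {p | ∀ q : X, ∑ i, dist p (a i) ≤ ∑ i, dist q (a i)}

/-- The normals of the twelve faces of the standard regular dodecahedron: the vertices
`(0, ±1, ±φ)`, `(±φ, 0, ±1)`, `(±1, ±φ, 0)` of a regular icosahedron, `φ` the golden ratio. -/
def dodecahedronNormals : Set (EuclideanSpace ℝ (Fin 3)) :=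
  {v | ∃ s t : ℝ, (s = 1 ∨ s = -1) ∧ (t = 1 ∨ t = -1) ∧
    (v = !₂[0, s, t * Real.goldenRatio] ∨
      v = !₂[t * Real.goldenRatio, 0, s] ∨
      v = !₂[s, t * Real.goldenRatio, 0])}

/-- The standard solid regular dodecahedron centred at the origin: the intersection of the twelve
half-spaces `⟪v, x⟫ ≤ 1`, whose outer normals `v` are the vertices of a regular icosahedron. -/
def regularDodecahedron : Set (EuclideanSpace ℝ (Fin 3)) :=
  {x | ∀ v ∈ dodecahedronNormals, inner ℝ v x ≤ 1}

/-!
In a space whose unit ball is the dodecahedron, the norm is the maximum of the twelve linear forms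
given by the vertices of the icosahedron (`inner_le_norm`, `exists_inner_eq_norm`).

The set of minimisers is compact and convex, so it is a segment as soon as it is contained in a
line (`exists_eq_segment_of_collinear`). Suppose that it contains three non-collinear points
`p`, `q`, `r`, with centroid `c`. A vertex `v` that attains the norm at `c - a i` also attains it
at `p - a i`, `q - a i` and `r - a i`, because the distance to `a i` at the centroid is the mean of
the distances at the three points. Hence the sum `S` of such vertices, one for each `i`, is
constant on `p`, `q`, `r`: it is orthogonal to the plane they span. There are two cases.

* For some `i` two vertices `v ≠ w` attain the norm. They agree on the plane as well, so `v - w` is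
  normal to it and `S` is a multiple of `v - w`. For `w = -v` all three points would coincide with
  `a i`; otherwise the equiangularity of the diagonals of the icosahedron makes it impossible
  (`add_add_ne_smul_sub`).
* For every `i` only one vertex attains the norm. Then the objective function is linear near its
  minimiser `c`, so `S = 0` (`sum_eq_zero_of_unique`), which is impossible too
  (`add_add_ne_zero`).

An example of non-uniqueness comes from three points of edges of the icosahedron that sum to zero,
whose normal cones (two of them in one plane, the third in a perpendicular plane) can be translated
so as to meet in a segment (`exists_nontrivial_fermatTorricelli`).
-/

open Filter Topology

local notation "E3" => EuclideanSpace ℝ (Fin 3)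

local notation "φ" => Real.goldenRatio

/-! ### The vertices of the icosahedron -/

lemma goldenRatio_bounds : (8 / 5 : ℝ) < φ ∧ φ < 17 / 10 := by
  have h := Real.goldenRatio_sq
  have h1 := Real.one_lt_goldenRatio
  constructor <;> nlinarith

lemma neg_mem_dodecahedronNormals {v : E3} (hv : v ∈ dodecahedronNormals) :
    -v ∈ dodecahedronNormals := by
  obtain ⟨s, t, hs, ht, h⟩ := hv
  refine ⟨-s, -t, ?_, ?_, ?_⟩
  · rcases hs with rfl | rfl <;> simp
  · rcases ht with rfl | rfl <;> simp
  · rcases h with rfl | rfl | rfl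
    · left; ext i; fin_cases i <;> simp
    · right; left; ext i; fin_cases i <;> simp
    · right; right; ext i; fin_cases i <;> simp

lemma finite_dodecahedronNormals : dodecahedronNormals.Finite := by
  have h : dodecahedronNormals ⊆
      (fun x : ℝ × ℝ => (!₂[0, x.1, x.2 * φ] : E3)) '' (({1, -1} : Set ℝ) ×ˢ {1, -1}) ∪
      (fun x : ℝ × ℝ => (!₂[x.2 * φ, 0, x.1] : E3)) '' (({1, -1} : Set ℝ) ×ˢ {1, -1}) ∪
      (fun x : ℝ × ℝ => (!₂[x.1, x.2 * φ, 0] : E3)) '' (({1, -1} : Set ℝ) ×ˢ {1, -1}) := by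
    rintro v ⟨s, t, hs, ht, h⟩
    have hst : (s, t) ∈ (({1, -1} : Set ℝ) ×ˢ ({1, -1} : Set ℝ)) := ⟨hs, ht⟩
    rcases h with rfl | rfl | rfl
    · exact Or.inl (Or.inl ⟨_, hst, rfl⟩)
    · exact Or.inl (Or.inr ⟨_, hst, rfl⟩)
    · exact Or.inr ⟨_, hst, rfl⟩
  have hf : (({1, -1} : Set ℝ) ×ˢ ({1, -1} : Set ℝ)).Finite :=
    (Set.toFinite _).prod (Set.toFinite _)
  exact (((hf.image _).union (hf.image _)).union (hf.image _)).subset h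

lemma inner_eq_coords (v w : E3) : inner ℝ v w = v 0 * w 0 + v 1 * w 1 + v 2 * w 2 := by
  simp [PiLp.inner_apply, Fin.sum_univ_three, mul_comm]

lemma inner_self_of_mem {v : E3} (hv : v ∈ dodecahedronNormals) : inner ℝ v v = φ + 2 := by
  have h2 := Real.goldenRatio_sq
  obtain ⟨s, t, hs, ht, h⟩ := hv
  have hs' : s * s = 1 := by rcases hs with rfl | rfl <;> norm_num
  have ht' : t * t = 1 := by rcases ht with rfl | rfl <;> norm_num
  rw [inner_eq_coords]
  rcases h with rfl | rfl | rfl <;> simp <;> linear_combination hs' + h2 + φ ^ 2 * ht'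

/-- The six diagonals of the icosahedron are equiangular. -/
lemma inner_of_mem {v w : E3} (hv : v ∈ dodecahedronNormals) (hw : w ∈ dodecahedronNormals) :
    inner ℝ v w = φ + 2 ∨ inner ℝ v w = -(φ + 2) ∨ inner ℝ v w = φ ∨ inner ℝ v w = -φ := by
  have h2 := Real.goldenRatio_sq
  have h3 : φ * φ = φ + 1 := by rw [← sq, h2]
  obtain ⟨s, t, hs, ht, h⟩ := hv
  obtain ⟨s', t', hs', ht', h'⟩ := hw
  rw [inner_eq_coords]
  rcases h with rfl | rfl | rfl <;> rcases h' with rfl | rfl | rfl <;>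
    rcases hs with rfl | rfl <;> rcases ht with rfl | rfl <;>
    rcases hs' with rfl | rfl <;> rcases ht' with rfl | rfl <;>
    simp [h3] <;> grind

lemma eq_of_inner_eq {v w : E3} (hv : v ∈ dodecahedronNormals) (hw : w ∈ dodecahedronNormals)
    (h : inner ℝ v w = φ + 2) : v = w := by
  rw [← sub_eq_zero, ← inner_self_eq_zero (𝕜 := ℝ), inner_sub_left, inner_sub_right,
    inner_sub_right, real_inner_comm v w, inner_self_of_mem hv, inner_self_of_mem hw, h]
  ring

lemma eq_neg_of_inner_eq {v w : E3} (hv : v ∈ dodecahedronNormals)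
    (hw : w ∈ dodecahedronNormals) (h : inner ℝ v w = -(φ + 2)) : v = -w :=
  eq_of_inner_eq hv (neg_mem_dodecahedronNormals hw) (by rw [inner_neg_right, h, neg_neg])

/-- No vertex of the icosahedron, as a vector, is parallel to the difference of two vertices that
are neither equal nor antipodal. -/
lemma ne_smul_sub {v w u : E3} (hv : v ∈ dodecahedronNormals) (hw : w ∈ dodecahedronNormals)
    (hu : u ∈ dodecahedronNormals) (hvw : inner ℝ v w = φ ∨ inner ℝ v w = -φ) (k : ℝ) :
    u ≠ k • (v - w) := by
  intro h
  have h2 := Real.goldenRatio_sq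
  obtain ⟨hl, hr⟩ := goldenRatio_bounds
  have hvv := inner_self_of_mem hv
  have hww := inner_self_of_mem hw
  have huu := inner_self_of_mem hu
  have huv := inner_of_mem hu hv
  have e1 : inner ℝ u v = k * (φ + 2 - inner ℝ v w) := by
    rw [h, inner_smul_left, inner_sub_left, hvv, real_inner_comm v w]; simp
  have e2 : inner ℝ u u = k * k * (2 * (φ + 2 - inner ℝ v w)) := by
    rw [h, inner_smul_left, inner_smul_right, inner_sub_left, inner_sub_right, inner_sub_right,
      hvv, hww, real_inner_comm v w]; simp; ring
  -- Eliminating `k` leaves a quadratic relation between the two inner products.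
  have e3 : 2 * (inner ℝ u v) ^ 2 = (φ + 2) * (φ + 2 - inner ℝ v w) := by
    rw [e1]; rw [huu] at e2
    linear_combination -(φ + 2 - inner ℝ v w) * e2
  rcases hvw with h' | h' <;> rw [h'] at e3 <;> rcases huv with h'' | h'' | h'' | h'' <;>
    rw [h''] at e3 <;> nlinarith

/-- The sum of three vertices of the icosahedron is never a multiple of the difference of the
first and a vertex neither equal nor antipodal to it; in particular, it is not zero. -/
lemma add_add_ne_smul_sub {v w u₁ u₂ : E3} (hv : v ∈ dodecahedronNormals)
    (hw : w ∈ dodecahedronNormals) (h₁ : u₁ ∈ dodecahedronNormals)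
    (h₂ : u₂ ∈ dodecahedronNormals) (hvw : inner ℝ v w = φ ∨ inner ℝ v w = -φ) (k : ℝ) :
    v + u₁ + u₂ ≠ k • (v - w) := by
  intro h
  obtain ⟨hl, hr⟩ := goldenRatio_bounds
  -- The vector `v + w` is orthogonal to `v - w`.
  have e : (φ + 2 + inner ℝ v w) + (inner ℝ u₁ v + inner ℝ u₁ w)
      + (inner ℝ u₂ v + inner ℝ u₂ w) = 0 := by
    have := congrArg (fun z => inner ℝ z (v + w)) h
    simp only [inner_add_left, inner_add_right, inner_smul_left, inner_sub_left,
      inner_self_of_mem hv, inner_self_of_mem hw, real_inner_comm v w] at this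
    linear_combination this
  -- Numerically, this forces one of the other two summands to be `-v` or `-w`; the remaining one
  -- is then a multiple of `v - w`.
  have key : u₁ = -v ∨ u₁ = -w ∨ u₂ = -v ∨ u₂ = -w := by
    by_contra! hne
    obtain ⟨n1, n2, n3, n4⟩ := hne
    have hrest : ∀ {u z : E3}, u ∈ dodecahedronNormals → z ∈ dodecahedronNormals → u ≠ -z →
        inner ℝ u z = φ + 2 ∨ inner ℝ u z = φ ∨ inner ℝ u z = -φ := fun hu hz hne =>
      (inner_of_mem hu hz).imp_right fun h => h.resolve_left fun h' =>
        hne (eq_neg_of_inner_eq hu hz h')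
    have a1 := hrest h₁ hv n1
    have a2 := hrest h₁ hw n2
    have a3 := hrest h₂ hv n3
    have a4 := hrest h₂ hw n4
    rcases hvw with h | h <;> rcases a1 with a1 | a1 | a1 <;> rcases a2 with a2 | a2 | a2 <;>
      rcases a3 with a3 | a3 | a3 <;> rcases a4 with a4 | a4 | a4 <;>
      rw [h, a1, a2, a3, a4] at e <;> linarith
  rcases key with rfl | rfl | rfl | rfl
  · exact ne_smul_sub hv hw h₂ hvw k (by rw [← h]; abel)
  · exact ne_smul_sub hv hw h₂ hvw (k - 1) (by rw [sub_smul, ← h, one_smul]; abel)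
  · exact ne_smul_sub hv hw h₁ hvw k (by rw [← h]; abel)
  · exact ne_smul_sub hv hw h₁ hvw (k - 1) (by rw [sub_smul, ← h, one_smul]; abel)

lemma exists_inner_eq_goldenRatio {v : E3} (hv : v ∈ dodecahedronNormals) :
    ∃ w ∈ dodecahedronNormals, inner ℝ v w = φ := by
  have h2 := Real.goldenRatio_sq
  obtain ⟨s, t, hs, ht, h⟩ := hv
  have hs' : -s = 1 ∨ -s = -1 := by rcases hs with rfl | rfl <;> simp
  have hs2 : s * s = 1 := by rcases hs with rfl | rfl <;> norm_num
  have ht2 : t * t = 1 := by rcases ht with rfl | rfl <;> norm_num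
  rcases h with rfl | rfl | rfl
  · refine ⟨!₂[0, -s, t * φ], ⟨-s, t, hs', ht, by simp⟩, ?_⟩
    simp [inner_eq_coords]; linear_combination -hs2 + h2 + φ ^ 2 * ht2
  · refine ⟨!₂[t * φ, 0, -s], ⟨-s, t, hs', ht, by simp⟩, ?_⟩
    simp [inner_eq_coords]; linear_combination -hs2 + h2 + φ ^ 2 * ht2
  · refine ⟨!₂[-s, t * φ, 0], ⟨-s, t, hs', ht, by simp⟩, ?_⟩
    simp [inner_eq_coords]; linear_combination -hs2 + h2 + φ ^ 2 * ht2

lemma add_add_ne_zero {v u₁ u₂ : E3} (hv : v ∈ dodecahedronNormals)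
    (h₁ : u₁ ∈ dodecahedronNormals) (h₂ : u₂ ∈ dodecahedronNormals) : v + u₁ + u₂ ≠ 0 := by
  obtain ⟨w, hw, h⟩ := exists_inner_eq_goldenRatio hv
  simpa using add_add_ne_smul_sub hv hw h₁ h₂ (Or.inl h) 0

/-! ### Two facts of linear geometry -/

/-- In a three-dimensional space, vectors orthogonal to a given plane are parallel. -/
lemma exists_eq_smul_of_inner_eq_zero {u w n s : E3} (huw : LinearIndependent ℝ ![u, w])
    (hn : n ≠ 0) (hnu : inner ℝ n u = 0) (hnw : inner ℝ n w = 0)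
    (hsu : inner ℝ s u = 0) (hsw : inner ℝ s w = 0) : ∃ k : ℝ, s = k • n := by
  set W := Submodule.span ℝ (Set.range ![u, w])
  have hmem : ∀ z : E3, inner ℝ z u = 0 → inner ℝ z w = 0 → z ∈ Wᗮ := by
    intro z hu hw
    refine (Submodule.mem_orthogonal' _ _).2 fun y hy => ?_
    refine Submodule.span_induction (p := fun y _ => inner ℝ z y = 0) ?_ (by simp) ?_ ?_ hy
    · rintro _ ⟨i, rfl⟩
      fin_cases i
      · exact hu
      · exact hw
    · intro a b _ _ ha hb; rw [inner_add_right, ha, hb, add_zero]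
    · intro c a _ ha; rw [inner_smul_right, ha, mul_zero]
  have hW : Module.finrank ℝ W = 2 := by
    simpa using finrank_span_eq_card huw
  have hWo : Module.finrank ℝ Wᗮ = 1 := by
    have := W.finrank_add_finrank_orthogonal
    rw [hW, finrank_euclideanSpace_fin] at this
    omega
  obtain ⟨k, hk⟩ := (finrank_eq_one_iff_of_nonzero' (⟨n, hmem n hnu hnw⟩ : Wᗮ)
    (by simpa using hn)).1 hWo ⟨s, hmem s hsu hsw⟩
  exact ⟨k, by simpa using (congrArg Subtype.val hk).symm⟩

/-- A compact convex subset of a line is a segment: it is spanned by two of its points at maximal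
distance. -/
lemma exists_eq_segment_of_collinear {X : Type*} [NormedAddCommGroup X] [NormedSpace ℝ X]
    {K : Set X} (hc : IsCompact K) (hconv : Convex ℝ K) (hcol : Collinear ℝ K)
    (hK : K.Nontrivial) : ∃ p q : X, p ≠ q ∧ K = segment ℝ p q := by
  obtain ⟨⟨p, q⟩, ⟨hp, hq⟩, hmax⟩ := (hc.prod hc).exists_isMaxOn
    (hK.nonempty.prod hK.nonempty) (continuous_dist.continuousOn)
  replace hmax : ∀ x ∈ K, ∀ y ∈ K, dist x y ≤ dist p q := fun x hx y hy =>
    hmax (Set.mk_mem_prod hx hy)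
  obtain ⟨x₀, hx₀, y₀, hy₀, hne⟩ := hK
  have hpos : 0 < dist p q := (dist_pos.2 hne).trans_le (hmax _ hx₀ _ hy₀)
  refine ⟨p, q, dist_pos.1 hpos, Set.Subset.antisymm (fun x hx => ?_) (hconv.segment_subset hp hq)⟩
  have h3 : Collinear ℝ ({p, x, q} : Set X) := hcol.subset (by
    rintro z (rfl | rfl | rfl) <;> assumption)
  rcases h3.wbtw_or_wbtw_or_wbtw with h | h | h
  · exact mem_segment_iff_wbtw.2 h
  · have := h.dist_add_dist
    have := hmax _ hx _ hp
    have : x = q := dist_le_zero.1 (by rw [dist_comm p q] at *; linarith)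
    rw [this]; exact right_mem_segment ℝ p q
  · have := h.dist_add_dist
    have := hmax _ hq _ hx
    have : p = x := dist_le_zero.1 (by rw [dist_comm p q] at *; linarith)
    rw [← this]; exact left_mem_segment ℝ p q

/-! ### The Fermat–Torricelli set in a normed space -/

section NormedSpace

variable {X : Type*} [NormedAddCommGroup X] [NormedSpace ℝ X]

lemma convex_fermatTorricelli {n : ℕ} (a : Fin n → X) : Convex ℝ (fermatTorricelli a) := by
  intro p hp q hq s t hs ht hst z
  have hconv : ConvexOn ℝ Set.univ (fun x : X => ∑ i, dist x (a i)) := by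
    refine ⟨convex_univ, fun x _ y _ s t hs ht hst => ?_⟩
    simp only [smul_eq_mul, Finset.mul_sum, ← Finset.sum_add_distrib]
    exact Finset.sum_le_sum fun i _ => (convexOn_univ_dist (a i)).2 trivial trivial hs ht hst
  have h := hconv.2 (Set.mem_univ p) (Set.mem_univ q) hs ht hst
  simp only [smul_eq_mul] at h
  refine h.trans ?_
  calc _ ≤ s * ∑ i, dist z (a i) + t * ∑ i, dist z (a i) :=
        add_le_add (mul_le_mul_of_nonneg_left (hp z) hs)
          (mul_le_mul_of_nonneg_left (hq z) ht)
    _ = _ := by rw [← add_mul, hst, one_mul]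

lemma isCompact_fermatTorricelli [FiniteDimensional ℝ X] {n : ℕ} (a : Fin (n + 1) → X) :
    IsCompact (fermatTorricelli a) := by
  have : ProperSpace X := FiniteDimensional.proper_real X
  refine Metric.isCompact_of_isClosed_isBounded ?_ ?_
  · simp only [fermatTorricelli, Set.ofPred_forall]
    exact isClosed_iInter fun q => isClosed_le (by fun_prop) continuous_const
  · refine (Metric.isBounded_closedBall (x := a 0)
      (r := ∑ i, dist (a 0) (a i))).subset fun p hp => ?_
    exact (Finset.single_le_sum (f := fun i => dist p (a i)) (fun i _ => dist_nonneg)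
      (Finset.mem_univ 0)).trans (hp (a 0))

/-- Three minimisers and their centroid: by convexity, each distance at the centroid is at most the mean
of the distances at the three points, and since the centroid does no better than they do, equality
holds throughout. -/
lemma three_mul_dist_centroid {n : ℕ} {a : Fin n → X} {p q r : X}
    (hp : p ∈ fermatTorricelli a) (hq : q ∈ fermatTorricelli a) (hr : r ∈ fermatTorricelli a)
    {c : X} (hc : (3 : ℝ) • c = p + q + r) (i : Fin n) :
    3 * ‖c - a i‖ = ‖p - a i‖ + ‖q - a i‖ + ‖r - a i‖ := by
  have hle : ∀ i ∈ Finset.univ, 3 * ‖c - a i‖ ≤ ‖p - a i‖ + ‖q - a i‖ + ‖r - a i‖ := by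
    intro i _
    have h : (3 : ℝ) • (c - a i) = (p - a i) + (q - a i) + (r - a i) := by
      rw [smul_sub, hc]; module
    calc 3 * ‖c - a i‖ = ‖(3 : ℝ) • (c - a i)‖ := by rw [norm_smul]; norm_num
      _ ≤ _ := by rw [h]; exact norm_add₃_le
  refine (Finset.sum_eq_sum_iff_of_le hle).1 ?_ i (Finset.mem_univ i)
  refine le_antisymm (Finset.sum_le_sum hle) ?_
  have h1 := hp c
  have h2 := hq c
  have h3 := hr c
  simp only [dist_eq_norm] at h1 h2 h3
  simp only [Finset.sum_add_distrib, ← Finset.mul_sum]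
  linarith

end NormedSpace

/-! ### Norms whose unit ball is a regular dodecahedron -/

section Dodecahedral

variable {X : Type*} [NormedAddCommGroup X] [NormedSpace ℝ X] {e : X ≃ₗ[ℝ] E3}

lemma inner_le_norm (he : e '' Metric.closedBall (0 : X) 1 = regularDodecahedron)
    {v : E3} (hv : v ∈ dodecahedronNormals) (x : X) : inner ℝ v (e x) ≤ ‖x‖ := by
  rcases eq_or_ne x 0 with rfl | hx
  · simp
  have hpos : 0 < ‖x‖ := norm_pos_iff.2 hx
  have h : e (‖x‖⁻¹ • x) ∈ regularDodecahedron := by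
    rw [← he]
    refine ⟨_, ?_, rfl⟩
    simp [norm_smul, hpos.ne']
  have := h v hv
  rw [map_smul, inner_smul_right, inv_mul_le_iff₀ hpos, mul_one] at this
  exact this

lemma exists_inner_eq_norm (he : e '' Metric.closedBall (0 : X) 1 = regularDodecahedron)
    (x : X) : ∃ v ∈ dodecahedronNormals, inner ℝ v (e x) = ‖x‖ := by
  have hne : dodecahedronNormals.Nonempty := ⟨_, 1, 1, Or.inl rfl, Or.inl rfl, Or.inl rfl⟩
  obtain ⟨v, hv, hmax⟩ := Set.exists_max_image dodecahedronNormals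
    (fun v => inner ℝ v (e x)) finite_dodecahedronNormals hne
  refine ⟨v, hv, le_antisymm (inner_le_norm he hv x) (le_of_forall_gt_imp_ge_of_dense ?_)⟩
  intro s hs
  have h0 : 0 ≤ inner ℝ v (e x) := by
    have := hmax _ (neg_mem_dodecahedronNormals hv)
    rw [inner_neg_left] at this
    linarith
  have hs0 : 0 < s := h0.trans_lt hs
  have h : e (s⁻¹ • x) ∈ regularDodecahedron := by
    intro w hw
    rw [map_smul, inner_smul_right, inv_mul_le_iff₀ hs0, mul_one]
    exact (hmax w hw).trans hs.le
  rw [← he] at h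
  obtain ⟨y, hy, hyx⟩ := h
  rw [e.injective hyx, mem_closedBall_zero_iff, norm_smul, norm_inv, Real.norm_of_nonneg hs0.le,
    inv_mul_le_iff₀ hs0, mul_one] at hy
  exact hy

/-- Where a single vertex `v` of the icosahedron attains the norm, the norm is locally the linear
form given by `v`. -/
lemma eventually_norm_add_smul_eq (he : e '' Metric.closedBall (0 : X) 1 = regularDodecahedron)
    {v : E3} {y : X}
    (huniq : ∀ w ∈ dodecahedronNormals, inner ℝ w (e y) = ‖y‖ → w = v) (d : X) :
    ∀ᶠ t : ℝ in 𝓝 0, ‖y + t • d‖ = inner ℝ v (e y) + t * inner ℝ v (e d) := by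
  have hv : inner ℝ v (e y) = ‖y‖ := by
    obtain ⟨w, hw, h⟩ := exists_inner_eq_norm he y
    rwa [huniq w hw h] at h
  have hev : ∀ᶠ t : ℝ in 𝓝 0, ∀ w ∈ dodecahedronNormals, w ≠ v →
      inner ℝ w (e y) + t * inner ℝ w (e d) < inner ℝ v (e y) + t * inner ℝ v (e d) := by
    refine (eventually_all_finite finite_dodecahedronNormals).2 fun w hw => ?_
    by_cases hwv : w = v
    · exact Eventually.of_forall fun t h => absurd hwv h
    have hlt : inner ℝ w (e y) < inner ℝ v (e y) :=
      hv ▸ (inner_le_norm he hw y).lt_of_ne fun h => hwv (huniq w hw h)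
    have hcont : ContinuousAt (fun t : ℝ => inner ℝ w (e y) + t * inner ℝ w (e d)) 0 := by
      fun_prop
    have hcont' : ContinuousAt (fun t : ℝ => inner ℝ v (e y) + t * inner ℝ v (e d)) 0 := by
      fun_prop
    filter_upwards [hcont.eventually_lt hcont' (by simpa using hlt)] with t ht _ using ht
  filter_upwards [hev] with t ht
  obtain ⟨w, hw, h⟩ := exists_inner_eq_norm he (y + t • d)
  obtain ⟨u, hu, hu'⟩ := exists_inner_eq_norm he y
  have hvmem : v ∈ dodecahedronNormals := huniq u hu hu' ▸ hu
  have hv' := inner_le_norm he hvmem (y + t • d)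
  rw [map_add, map_smul, inner_add_right, inner_smul_right] at h hv'
  by_cases hwv : w = v
  · rw [← h, hwv]
  · linarith [ht w hw hwv]

/-- If at a minimiser each of the norms involved is attained by a single vertex of the
icosahedron, then these vertices sum to zero. -/
lemma sum_eq_zero_of_unique (he : e '' Metric.closedBall (0 : X) 1 = regularDodecahedron)
    {n : ℕ} {a : Fin n → X} {c : X} (hc : c ∈ fermatTorricelli a) {v : Fin n → E3}
    (huniq : ∀ i, ∀ w ∈ dodecahedronNormals, inner ℝ w (e (c - a i)) = ‖c - a i‖ → w = v i) :
    ∑ i, v i = 0 := by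
  -- The objective function decreases from `c` in the direction of minus the sum.
  set d : X := e.symm (-∑ i, v i)
  have hev := eventually_all.2 fun i => eventually_norm_add_smul_eq he (huniq i) d
  obtain ⟨t, ht, ht0⟩ :=
    ((hev.filter_mono (nhdsWithin_le_nhds (s := Set.Ioi 0))).and self_mem_nhdsWithin).exists
  have h := hc (c + t • d)
  have h0 : ∀ i, ‖c - a i‖ = inner ℝ (v i) (e (c - a i)) := fun i => by
    obtain ⟨w, hw, h⟩ := exists_inner_eq_norm he (c - a i)
    rw [← huniq i w hw h, h]
  have h1 : ∀ i, dist (c + t • d) (a i) = dist c (a i) + t * inner ℝ (v i) (e d) := fun i => by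
    rw [dist_eq_norm, dist_eq_norm, h0, ← ht i]; congr 1; abel
  simp only [h1, Finset.sum_add_distrib, ← Finset.mul_sum, ← sum_inner] at h
  have h2 : 0 ≤ t * inner ℝ (∑ i, v i) (e d) := by linarith
  have h3 := nonneg_of_mul_nonneg_right h2 ht0
  rw [LinearEquiv.apply_symm_apply, inner_neg_right] at h3
  exact inner_self_eq_zero (𝕜 := ℝ).1 (le_antisymm (by linarith) real_inner_self_nonneg)

/-- A vertex of the icosahedron attaining the norm at `c - a i`, where `c` is the centroid of three
minimisers, attains it at all three of them. -/
lemma inner_eq_norm_of_centroid (he : e '' Metric.closedBall (0 : X) 1 = regularDodecahedron)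
    {n : ℕ} {a : Fin n → X} {p q r c : X}
    (hp : p ∈ fermatTorricelli a) (hq : q ∈ fermatTorricelli a) (hr : r ∈ fermatTorricelli a)
    (hc : (3 : ℝ) • c = p + q + r) {i : Fin n} {v : E3} (hv : v ∈ dodecahedronNormals)
    (h : inner ℝ v (e (c - a i)) = ‖c - a i‖) :
    inner ℝ v (e (p - a i)) = ‖p - a i‖ ∧ inner ℝ v (e (q - a i)) = ‖q - a i‖ ∧
      inner ℝ v (e (r - a i)) = ‖r - a i‖ := by
  have h3 := three_mul_dist_centroid hp hq hr hc i
  have h1 : (3 : ℝ) • (c - a i) = (p - a i) + (q - a i) + (r - a i) := by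
    rw [smul_sub, hc]; module
  have h2 : 3 * inner ℝ v (e (c - a i)) = inner ℝ v (e (p - a i)) + inner ℝ v (e (q - a i))
      + inner ℝ v (e (r - a i)) := by
    rw [← inner_smul_right, ← map_smul, h1]; simp only [map_add, inner_add_right]
  have b1 := inner_le_norm he hv (p - a i)
  have b2 := inner_le_norm he hv (q - a i)
  have b3 := inner_le_norm he hv (r - a i)
  refine ⟨?_, ?_, ?_⟩ <;> linarith

/-- Two different vertices cannot attain the norm at `c - a i`: their difference would be the
normal of the plane through `p`, `q`, `r`, and so parallel to the sum of the three vertices. -/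
lemma eq_of_inner_eq_norm (he : e '' Metric.closedBall (0 : X) 1 = regularDodecahedron)
    {a : Fin 3 → X} {p q r c : X}
    (hp : p ∈ fermatTorricelli a) (hq : q ∈ fermatTorricelli a) (hr : r ∈ fermatTorricelli a)
    (hc : (3 : ℝ) • c = p + q + r) (hli : LinearIndependent ℝ ![e (q - p), e (r - p)])
    {v : Fin 3 → E3} (hv : ∀ i, v i ∈ dodecahedronNormals)
    (hact : ∀ i, inner ℝ (v i) (e (c - a i)) = ‖c - a i‖) (i : Fin 3) {w : E3}
    (hw : w ∈ dodecahedronNormals) (hw' : inner ℝ w (e (c - a i)) = ‖c - a i‖) : w = v i := by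
  by_contra hne
  have hdiff : ∀ (u : E3) (x y : X) (i : Fin 3), inner ℝ u (e (x - y)) =
      inner ℝ u (e (x - a i)) - inner ℝ u (e (y - a i)) := fun u x y i => by
    rw [← inner_sub_right, ← map_sub, sub_sub_sub_cancel_right]
  have hvi := fun j => inner_eq_norm_of_centroid he hp hq hr hc (hv j) (hact j)
  have hwi := inner_eq_norm_of_centroid he hp hq hr hc hw hw'
  have hval : ∀ x ∈ fermatTorricelli a, ∀ y ∈ fermatTorricelli a,
      ∑ j, ‖x - a j‖ = ∑ j, ‖y - a j‖ := fun x hx y hy => by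
    simpa only [dist_eq_norm] using le_antisymm (hx y) (hy x)
  have hSq : inner ℝ (∑ j, v j) (e (q - p)) = 0 := by
    rw [sum_inner, Finset.sum_congr rfl fun j _ => (hdiff (v j) q p j).trans
      (by rw [(hvi j).1, (hvi j).2.1]), Finset.sum_sub_distrib, hval q hq p hp, sub_self]
  have hSr : inner ℝ (∑ j, v j) (e (r - p)) = 0 := by
    rw [sum_inner, Finset.sum_congr rfl fun j _ => (hdiff (v j) r p j).trans
      (by rw [(hvi j).1, (hvi j).2.2]), Finset.sum_sub_distrib, hval r hr p hp, sub_self]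
  have hnq : inner ℝ (v i - w) (e (q - p)) = 0 := by
    rw [inner_sub_left, hdiff _ q p i, hdiff _ q p i, (hvi i).1, (hvi i).2.1, hwi.1, hwi.2.1,
      sub_self]
  have hnr : inner ℝ (v i - w) (e (r - p)) = 0 := by
    rw [inner_sub_left, hdiff _ r p i, hdiff _ r p i, (hvi i).1, (hvi i).2.2, hwi.1, hwi.2.2,
      sub_self]
  obtain ⟨k, hk⟩ := exists_eq_smul_of_inner_eq_zero hli (sub_ne_zero.2 (Ne.symm hne)) hnq hnr
    hSq hSr
  rcases inner_of_mem (hv i) hw with h | h | h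
  · exact hne (eq_of_inner_eq (hv i) hw h).symm
  · -- Antipodal vertices attain the norm only at zero; but `p`, `q` and `r` do not all equal `a i`.
    have hz := eq_neg_of_inner_eq (hv i) hw h
    have hzero : ∀ x : X, inner ℝ (v i) (e (x - a i)) = ‖x - a i‖ →
        inner ℝ w (e (x - a i)) = ‖x - a i‖ → x = a i := fun x h1 h2 => by
      rw [hz, inner_neg_left] at h1
      exact sub_eq_zero.1 (norm_eq_zero.1 (by linarith))
    have h1 := hzero p (hvi i).1 hwi.1
    have h2 := hzero q (hvi i).2.1 hwi.2.1
    exact hli.ne_zero 0 (by simp [h1, h2])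
  · rw [Fin.sum_univ_three] at hk
    fin_cases i
    · exact add_add_ne_smul_sub (hv 0) hw (hv 1) (hv 2) h k hk
    · exact add_add_ne_smul_sub (hv 1) hw (hv 0) (hv 2) h k (.trans (by abel) hk)
    · exact add_add_ne_smul_sub (hv 2) hw (hv 0) (hv 1) h k (.trans (by abel) hk)

lemma collinear_fermatTorricelli (he : e '' Metric.closedBall (0 : X) 1 = regularDodecahedron)
    (a : Fin 3 → X) : Collinear ℝ (fermatTorricelli a) := by
  rcases (fermatTorricelli a).subsingleton_or_nontrivial with h | ⟨p, hp, q, hq, hpq⟩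
  · rcases h.eq_empty_or_singleton with h | ⟨x, h⟩ <;> rw [h]
    exacts [collinear_empty ℝ X, collinear_singleton ℝ x]
  refine (collinear_iff_of_mem hp).2 ⟨q - p, fun r hr => ?_⟩
  by_contra! hcon
  have hli : LinearIndependent ℝ ![e (q - p), e (r - p)] := by
    refine (LinearIndependent.pair_iff' (by simpa [sub_eq_zero] using hpq.symm)).2 fun k hk => ?_
    rw [← map_smul] at hk
    exact hcon k (by rw [e.injective hk]; simp)
  set c : X := (3⁻¹ : ℝ) • (p + q + r)
  have hc : (3 : ℝ) • c = p + q + r := smul_inv_smul₀ (by norm_num) _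
  have hcm : c ∈ fermatTorricelli a := fun z => by
    have h1 := Finset.sum_congr rfl fun i (_ : i ∈ Finset.univ) =>
      three_mul_dist_centroid hp hq hr hc i
    have hpz := hp z
    have hqz := hq z
    have hrz := hr z
    simp only [Finset.sum_add_distrib, ← Finset.mul_sum, ← dist_eq_norm] at h1
    linarith
  choose v hv hact using fun i => exists_inner_eq_norm he (c - a i)
  have h0 := sum_eq_zero_of_unique he hcm fun i w hw hw' =>
    eq_of_inner_eq_norm he hp hq hr hc hli hv hact i hw hw'
  rw [Fin.sum_univ_three] at h0
  exact add_add_ne_zero (hv 0) (hv 1) (hv 2) h0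

/-! ### Three points with several minimisers -/

lemma norm_symm_le (he : e '' Metric.closedBall (0 : X) 1 = regularDodecahedron) {y : E3}
    {r : ℝ} (h : ∀ s t : ℝ, (s = 1 ∨ s = -1) → (t = 1 ∨ t = -1) →
      s * y 1 + t * φ * y 2 ≤ r ∧ t * φ * y 0 + s * y 2 ≤ r ∧ s * y 0 + t * φ * y 1 ≤ r) :
    ‖e.symm y‖ ≤ r := by
  obtain ⟨v, ⟨s, t, hs, ht, hv⟩, hy⟩ := exists_inner_eq_norm he (e.symm y)
  rw [← hy, e.apply_symm_apply, inner_eq_coords]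
  obtain ⟨h1, h2, h3⟩ := h s t hs ht
  rcases hv with rfl | rfl | rfl <;> simpa

lemma exists_nontrivial_fermatTorricelli
    (he : e '' Metric.closedBall (0 : X) 1 = regularDodecahedron) :
    ∃ a : Fin 3 → X, Function.Injective a ∧ (fermatTorricelli a).Nontrivial := by
  obtain ⟨hl, hr⟩ := goldenRatio_bounds
  set b : Fin 3 → E3 := ![!₂[0, 0, -3], !₂[-1, 0, 0], !₂[1, 0, 0]] with hb
  -- The midpoint `(0, 0, φ)` of an edge of the icosahedron and the points `(±φ, 0, -φ/2)` of two
  -- opposite edges sum to zero. As linear forms bounded by the norm, applied to the differences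
  -- `z - a i`, they add up to a constant lower bound of the objective function.
  have hlow : ∀ z : X, 5 * φ ≤ ∑ i, dist z (e.symm (b i)) := by
    intro z
    have hle : ∀ {v : E3}, v ∈ dodecahedronNormals → ∀ i,
        inner ℝ v (e z - b i) ≤ dist z (e.symm (b i)) := fun hv i => by
      simpa [dist_eq_norm] using inner_le_norm he hv (z - e.symm (b i))
    have h1 := hle ⟨1, 1, by simp, by simp, Or.inl rfl⟩ 0
    have h2 := hle ⟨-1, 1, by simp, by simp, Or.inl rfl⟩ 0
    have h3 := hle ⟨1, 1, by simp, by simp, Or.inr (Or.inl rfl)⟩ 1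
    have h4 := hle ⟨-1, 1, by simp, by simp, Or.inr (Or.inl rfl)⟩ 1
    have h5 := hle ⟨1, -1, by simp, by simp, Or.inr (Or.inl rfl)⟩ 2
    have h6 := hle ⟨-1, -1, by simp, by simp, Or.inr (Or.inl rfl)⟩ 2
    simp only [inner_eq_coords, hb] at h1 h2 h3 h4 h5 h6
    simp at h1 h2 h3 h4 h5 h6
    rw [Fin.sum_univ_three]
    simp only [hb]
    simp
    nlinarith
  have hmem : ∀ x : ℝ, 0 ≤ x → x ≤ 1 / 2 →
      e.symm !₂[x, 0, 0] ∈ fermatTorricelli fun i => e.symm (b i) := by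
    intro x hx0 hx1 z
    refine le_trans ?_ (hlow z)
    have hn : ∀ i, dist (e.symm !₂[x, 0, 0]) (e.symm (b i)) = ‖e.symm (!₂[x, 0, 0] - b i)‖ :=
      fun i => by rw [dist_eq_norm, map_sub]
    have h0 : ‖e.symm (!₂[x, 0, 0] - b 0)‖ ≤ 3 * φ := by
      refine norm_symm_le he fun s t hs ht => ?_
      simp only [hb]
      simp
      rcases hs with rfl | rfl <;> rcases ht with rfl | rfl <;> refine ⟨?_, ?_, ?_⟩ <;> nlinarith
    have h1 : ‖e.symm (!₂[x, 0, 0] - b 1)‖ ≤ (1 + x) * φ := by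
      refine norm_symm_le he fun s t hs ht => ?_
      simp only [hb]
      simp
      rcases hs with rfl | rfl <;> rcases ht with rfl | rfl <;> refine ⟨?_, ?_, ?_⟩ <;> nlinarith
    have h2 : ‖e.symm (!₂[x, 0, 0] - b 2)‖ ≤ (1 - x) * φ := by
      refine norm_symm_le he fun s t hs ht => ?_
      simp only [hb]
      simp
      rcases hs with rfl | rfl <;> rcases ht with rfl | rfl <;> refine ⟨?_, ?_, ?_⟩ <;> nlinarith
    rw [Fin.sum_univ_three, hn, hn, hn]
    linarith
  refine ⟨fun i => e.symm (b i), e.symm.injective.comp ?_, _, hmem 0 le_rfl (by norm_num), _,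
    hmem (1 / 2) (by norm_num) le_rfl, fun h => ?_⟩
  · intro i j hij
    have c0 := congrArg (fun y : E3 => y 0) hij
    have c2 := congrArg (fun y : E3 => y 2) hij
    fin_cases i <;> fin_cases j <;> simp [hb] at c0 c2 ⊢ <;> norm_num at c0
  · have := congrArg (fun y : E3 => y 0) (e.symm.injective h)
    norm_num at this

end Dodecahedral

theorem mainTheorem5 {X : Type*} [NormedAddCommGroup X] [NormedSpace ℝ X]
    (e : X ≃ₗ[ℝ] EuclideanSpace ℝ (Fin 3))
    (he : e '' Metric.closedBall (0 : X) 1 = regularDodecahedron) :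
    (∃ a : Fin 3 → X, Function.Injective a ∧ (fermatTorricelli a).Nontrivial) ∧
      ∀ a : Fin 3 → X, (fermatTorricelli a).Nontrivial →
        ∃ p q : X, p ≠ q ∧ fermatTorricelli a = segment ℝ p q := by
  have : FiniteDimensional ℝ X := e.symm.finiteDimensional
  exact ⟨exists_nontrivial_fermatTorricelli he, fun a ha =>
    exists_eq_segment_of_collinear (isCompact_fermatTorricelli a) (convex_fermatTorricelli a)
      (collinear_fermatTorricelli he a) ha⟩
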